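/- Let $A$ be an Artin algebra, i.e. an algebra over a commutative Artinian ring $R$ that is finitely generated as an $R$-module. All modules are finitely generated. For a left (resp. right) module $M$ over a ring $S$, let $M^*=\operatorname{Hom}_S(M,S)$, a right (resp. left) $S$-module, and write $f^*$ for the map $g\mapsto g\circ f$ induced on duals by a module map $f$. For a left module $M$ let $\phi_M\colon M\to M^{**}$, $\phi_M(m)(f)=f(m)$, be the canonical map. $M$ is *torsionless* if $\phi_M$ is a monomorphism (equivalently, $M$ is a submodule of a projective module). A left or right $S$-module $M$ is *semi-Gorenstein-projective* if $\operatorname{Ext}^i_S(M,S)=0$ for all $i\ge 1$, where $\operatorname{Ext}$ and $S$ are taken on the same side as $M$; a left module $M$ is *double semi-Gorenstein-projective* if both $M$ and $M^*$ are semi-Gorenstein-projective. Let $\Lambda=T_2(A)=\begin{pmatrix}A&A\\0&A\end{pmatrix}$. A left $\Lambda$-module is given by a triple $\binom XY_\varphi$, where $\varphi\colon Y\to X$ is a map of left $A$-modules; its elements are the columns $\binom xy$ with $x\in X$, $y\in Y$, and $\begin{pmatrix}a&b\\0&d\end{pmatrix}\binom xy=\binom{ax+b\varphi(y)}{dy}$.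 Let $\pi\colon X\to\operatorname{Coker}\varphi$ be the projection, $\pi^*\colon(\operatorname{Coker}\varphi)^*\to X^*$ its dual, $p\colon X^*\to\operatorname{Coker}\pi^*$ the projection, and $\beta\colon\operatorname{Coker}\pi^*\to Y^*$ the unique $A$-map with $\beta p=\varphi^*$. Then, for every left $\Lambda$-module $\binom XY_\varphi$: (1) The map $p^*\colon(\operatorname{Coker}\pi^*)^*\to X^{**}$ is a monomorphism, and there is an isomorphism of left $\Lambda$-modules $$\widetilde h\colon\binom{X^{**}}{(\operatorname{Coker}\pi^*)^*}_{p^*}\longrightarrow\binom XY_\varphi^{**}$$ such that, whenever $f\in\binom XY_\varphi^*$, $g\in(\operatorname{Coker}\varphi)^*$ and $\alpha\in X^*$ satisfy $f\binom xy=\begin{pmatrix}g(\pi(x))&\alpha(x)\\0&\alpha(\varphi(y))\end{pmatrix}$ for all $x\in X$, $y\in Y$, one has $$\widetilde h\binom bc(f)=\begin{pmatrix}b(\pi^*(g))&b(\alpha)\\0&c(p(\alpha))\end{pmatrix}\qquad\text{for all } b\in X^{**},\ c\in(\operatorname{Coker}\pi^*)^*.$$ Taking $\widetilde h$ as the identity,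 the canonical map of $\binom XY_\varphi$ is $\binom{\phi_X}{\beta^*\phi_Y}$; that is, $\phi_{\binom XY_\varphi}\binom xy=\widetilde h\binom{\phi_X(x)}{\beta^*(\phi_Y(y))}$ for all $x\in X$, $y\in Y$. (2) $\binom XY_\varphi$ is torsionless and double semi-Gorenstein-projective if and only if $\varphi$ is a monomorphism, $X$, $Y$ and $\operatorname{Coker}\varphi$ are double semi-Gorenstein-projective, and $X$ and $Y$ are torsionless. (3) $\binom XY_\varphi$ is double semi-Gorenstein-projective with $\phi_{\binom XY_\varphi}$ an epimorphism if and only if $\varphi^*\colon X^*\to Y^*$ is an epimorphism, $X$ and $Y$ are double semi-Gorenstein-projective, $(\operatorname{Coker}\varphi)^*$ is semi-Gorenstein-projective, and $\phi_X$ and $\phi_Y$ are epimorphisms. -/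

import Mathlib

open CategoryTheory MulOpposite

universe u

noncomputable section

namespace T2Modules

section Duality

variable (A : Type u) [Ring A]

/-- The dual `Hom_A(M, A)` of a left `A`-module `M`. Mathlib makes it a right `A`-module, i.e. a
module over `Aᵐᵒᵖ`, by `(f a)(m) = f(m) a`. -/
abbrev LDual (M : Type u) [AddCommGroup M] [Module A M] : Type u := M →ₗ[A] A

/-- The dual `Hom_A(U, A_A)` of a right `A`-module `U`. Mathlib makes it a left `A`-module
by `(a f)(u) = a f(u)`. -/
abbrev RDual (U : Type u) [AddCommGroup U] [Module Aᵐᵒᵖ U] : Type u := U →ₗ[Aᵐᵒᵖ] A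

variable {A}

/-- `f^* : N^* → M^*`, `g ↦ g ∘ f`, for a map `f : M → N` of left modules. -/
def lDualMap {M N : Type u} [AddCommGroup M] [Module A M] [AddCommGroup N] [Module A N]
    (f : M →ₗ[A] N) : LDual A N →ₗ[Aᵐᵒᵖ] LDual A M where
  toFun g := g.comp f
  map_add' _ _ := rfl
  map_smul' _ _ := rfl

/-- `f^* : V^* → U^*`, `g ↦ g ∘ f`, for a map `f : U → V` of right modules. -/
def rDualMap {U V : Type u} [AddCommGroup U] [Module Aᵐᵒᵖ U] [AddCommGroup V] [Module Aᵐᵒᵖ V]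
    (f : U →ₗ[Aᵐᵒᵖ] V) : RDual A V →ₗ[A] RDual A U where
  toFun g := g.comp f
  map_add' _ _ := rfl
  map_smul' _ _ := rfl

variable (A)

/-- The canonical map `φ_M : M → M^{**}`, `φ_M(m)(f) = f(m)`, of a left module `M`. -/
def canon (M : Type u) [AddCommGroup M] [Module A M] : M →ₗ[A] RDual A (LDual A M) where
  toFun m :=
    { toFun := fun f => f m
      map_add' := fun _ _ => rfl
      map_smul' := fun _ _ => rfl }
  map_add' m n := by ext f; exact map_add f m n
  map_smul' a m := by ext f; exact map_smul f a m

/-- `Ext_S^i(M, N) = 0` for all `i ≥ 1`. -/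
def ExtVanishes (S : Type u) [Ring S] (M N : Type u) [AddCommGroup M] [Module S M]
    [AddCommGroup N] [Module S N] : Prop :=
  ∀ i : ℕ, 1 ≤ i → Subsingleton (Abelian.Ext (ModuleCat.of S M) (ModuleCat.of S N) i)

/-- A left `A`-module `M` is semi-Gorenstein-projective if `Ext_A^i(M, A) = 0` for `i ≥ 1`. -/
def SemiGP (M : Type u) [AddCommGroup M] [Module A M] : Prop :=
  ExtVanishes A M A

/-- A right `A`-module `U` is semi-Gorenstein-projective if `Ext^i(U, A_A) = 0` for `i ≥ 1`,
the `Ext` being that of right `A`-modules. -/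
def RSemiGP (U : Type u) [AddCommGroup U] [Module Aᵐᵒᵖ U] : Prop :=
  ExtVanishes Aᵐᵒᵖ U A

/-- A left module `M` is double semi-Gorenstein-projective if both `M` and `M^*` are
semi-Gorenstein-projective. -/
def DoubleSemiGP (M : Type u) [AddCommGroup M] [Module A M] : Prop :=
  SemiGP A M ∧ RSemiGP A (LDual A M)

/-- A left module `M` is torsionless if `φ_M` is a monomorphism. -/
def Torsionless (M : Type u) [AddCommGroup M] [Module A M] : Prop :=
  Function.Injective (canon A M)

end Duality

/-- The ring `T₂(A)` of upper triangular `2 × 2` matrices over `A`. -/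
def T2 (A : Type u) [Ring A] : Subring (Matrix (Fin 2) (Fin 2) A) where
  carrier := {m | m 1 0 = 0}
  mul_mem' {a b} ha hb := by
    simp only [Set.mem_ofPred_eq] at ha hb ⊢
    simp [Matrix.mul_apply, Fin.sum_univ_two, ha, hb]
  one_mem' := by simp
  add_mem' {a b} ha hb := by
    simp only [Set.mem_ofPred_eq] at ha hb ⊢
    simp [ha, hb]
  zero_mem' := by simp
  neg_mem' {a} ha := by
    simp only [Set.mem_ofPred_eq] at ha ⊢
    simp [ha]

section Triples

variable {A : Type u} [Ring A] {X Y : Type u} [AddCommGroup X] [Module A X]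
  [AddCommGroup Y] [Module A Y]

/-- The left `T₂(A)`-module `(X, Y)_φ` of an `A`-map `φ : Y → X`: its elements are the columns
`(x, y)`, and the matrix `(a b; 0 d)` sends `(x, y)` to `(a x + b φ(y), d y)`. -/
def Triple (_φ : Y →ₗ[A] X) : Type u := X × Y

instance (φ : Y →ₗ[A] X) : AddCommGroup (Triple φ) := inferInstanceAs (AddCommGroup (X × Y))

/-- The element `(x, y)` of `(X, Y)_φ`. -/
def Triple.mk (φ : Y →ₗ[A] X) (x : X) (y : Y) : Triple φ := (x, y)

instance (φ : Y →ₗ[A] X) : Module (T2 A) (Triple φ) where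
  smul m z := (m.1 0 0 • z.1 + m.1 0 1 • φ z.2, m.1 1 1 • z.2)
  one_smul z := by
    refine Prod.ext ?_ ?_
    · change (1 : Matrix (Fin 2) (Fin 2) A) 0 0 • z.1
        + (1 : Matrix (Fin 2) (Fin 2) A) 0 1 • φ z.2 = z.1
      simp
    · change (1 : Matrix (Fin 2) (Fin 2) A) 1 1 • z.2 = z.2
      simp
  mul_smul m n z := by
    have hn : n.1 1 0 = 0 := n.2
    have hm : m.1 1 0 = 0 := m.2
    refine Prod.ext ?_ ?_
    · change (m.1 * n.1) 0 0 • z.1 + (m.1 * n.1) 0 1 • φ z.2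
        = m.1 0 0 • (n.1 0 0 • z.1 + n.1 0 1 • φ z.2) + m.1 0 1 • φ (n.1 1 1 • z.2)
      simp [Matrix.mul_apply, Fin.sum_univ_two, hn, add_smul, mul_smul, add_assoc]
    · change (m.1 * n.1) 1 1 • z.2 = m.1 1 1 • n.1 1 1 • z.2
      simp [Matrix.mul_apply, Fin.sum_univ_two, hm, mul_smul]
  smul_zero m := by
    refine Prod.ext ?_ ?_
    · change m.1 0 0 • (0 : X) + m.1 0 1 • φ 0 = 0
      simp
    · change m.1 1 1 • (0 : Y) = 0
      simp
  smul_add m z w := by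
    refine Prod.ext ?_ ?_
    · change m.1 0 0 • (z.1 + w.1) + m.1 0 1 • φ (z.2 + w.2)
        = (m.1 0 0 • z.1 + m.1 0 1 • φ z.2) + (m.1 0 0 • w.1 + m.1 0 1 • φ w.2)
      simp only [smul_add, map_add]
      abel
    · exact smul_add _ z.2 w.2
  add_smul m n z := by
    refine Prod.ext ?_ ?_
    · change (m.1 0 0 + n.1 0 0) • z.1 + (m.1 0 1 + n.1 0 1) • φ z.2
        = (m.1 0 0 • z.1 + m.1 0 1 • φ z.2) + (n.1 0 0 • z.1 + n.1 0 1 • φ z.2)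
      simp only [add_smul]
      abel
    · exact add_smul _ _ z.2
  zero_smul z := by
    refine Prod.ext ?_ ?_
    · change (0 : A) • z.1 + (0 : A) • φ z.2 = 0
      simp
    · exact zero_smul A z.2

/-- `Coker φ`. -/
abbrev Coker (φ : Y →ₗ[A] X) : Type u := X ⧸ LinearMap.range φ

/-- The projection `π : X → Coker φ`. -/
abbrev proj (φ : Y →ₗ[A] X) : X →ₗ[A] Coker φ := (LinearMap.range φ).mkQ

/-- `Coker π^*`, where `π^* : (Coker φ)^* → X^*`; a right `A`-module. -/
abbrev CokerPiStar (φ : Y →ₗ[A] X) : Type u :=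
  LDual A X ⧸ LinearMap.range (lDualMap (proj φ))

/-- The projection `p : X^* → Coker π^*`. -/
abbrev pMap (φ : Y →ₗ[A] X) : LDual A X →ₗ[Aᵐᵒᵖ] CokerPiStar φ :=
  (LinearMap.range (lDualMap (proj φ))).mkQ

/-- The map `β : Coker π^* → Y^*` with `β ∘ p = φ^*`. -/
def beta (φ : Y →ₗ[A] X) : CokerPiStar φ →ₗ[Aᵐᵒᵖ] LDual A Y :=
  (LinearMap.range (lDualMap (proj φ))).liftQ (lDualMap φ) (by
    rintro _ ⟨g, rfl⟩
    ext y
    change g ((LinearMap.range φ).mkQ (φ y)) = 0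
    rw [Submodule.mkQ_apply, (Submodule.Quotient.mk_eq_zero _).2 (LinearMap.mem_range_self φ y),
      map_zero])

end Triples

end T2Modules

end

/-!
For a `B`-module `N`, the coinduced module `Hom_B(T₂(B), N)` is `(N, N) ⊕ (0, N)`. Since `T₂(B)` is
projective over `B`, coinduction is right adjoint to an exact functor preserving projectives, so
`Ext` from `(X, Y)_φ` to `(N, N) ⊕ (0, N)` is `Ext_B(X ⊕ Y, N)`. The sequence
`0 → (N, 0) → (N, N) → (0, N) → 0` then shows that `Ext` from `(X, Y)_φ` to `(N, N) ⊕ (N, 0)`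
vanishes in positive degrees iff the same holds for `Ext_B(X, N)` and `Ext_B(Y, N)` and
`φ^* : Hom(X, N) → Hom(Y, N)` is onto.

For `N = A` the module `(N, N) ⊕ (N, 0)` is the left module `T₂(A)`, and, through
`T₂(A)ᵐᵒᵖ ≃ T₂(Aᵐᵒᵖ)`, the same module over `Aᵐᵒᵖ` is the right module `T₂(A)`. So the criterion
applies both to `(X, Y)_φ` and to its dual, which is the triple of `π^* : (Coker φ)^* → X^*`. When
`φ^*` is onto, `Y^* = Coker π^*`, which makes `β^*` bijective and turns the second instance of the
criterion into a statement about `Y^*`.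
-/

noncomputable section

namespace T2Modules

theorem surjective_iff_of_comm {α β α' β' : Type*} {f : α → β} {f' : α' → β'} (e : α ≃ α')
    (e' : β ≃ β') (comm : ∀ a, e' (f a) = f' (e a)) :
    Function.Surjective f ↔ Function.Surjective f' := by
  rw [← Equiv.comp_surjective f e', ← e.surjective_comp f']
  exact iff_of_eq (congrArg _ (funext comm))

theorem surjective_iff_subsingleton {α β : Type*} [Nonempty α] [Subsingleton α] {f : α → β} :
    Function.Surjective f ↔ Subsingleton β :=
  ⟨fun h => h.subsingleton, fun _ => Function.surjective_to_subsingleton f⟩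

theorem subsingleton_prod_iff {α β : Type*} [Nonempty α] [Nonempty β] :
    Subsingleton (α × β) ↔ Subsingleton α ∧ Subsingleton β :=
  ⟨fun _ => ⟨(Prod.fst_surjective (β := β)).subsingleton,
    (Prod.snd_surjective (α := α)).subsingleton⟩,
  fun ⟨_, _⟩ => inferInstance⟩

section AbelianExt

open Abelian Limits

universe w w' v v' u'

variable {C : Type u} [Category.{v} C] [Abelian C] [HasExt.{w} C]

theorem subsingleton_ext_congr {X X' Y Y' : C} (e : X ≅ X') (e' : Y ≅ Y') (n : ℕ) :
    Subsingleton (Ext X Y n) ↔ Subsingleton (Ext X' Y' n) :=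
  (((extFunctor n).mapIso e.symm.op).app Y ≪≫
    ((extFunctor n).obj (.op X')).mapIso e').addCommGroupIsoToAddEquiv.subsingleton_congr

theorem subsingleton_ext_biprod_left_iff {X X' Y : C} {n : ℕ} :
    Subsingleton (Ext (X ⊞ X') Y n) ↔ Subsingleton (Ext X Y n) ∧ Subsingleton (Ext X' Y n) :=
  Ext.biprodAddEquiv.subsingleton_congr.trans subsingleton_prod_iff

theorem subsingleton_ext_biprod_right_iff {X Y Y' : C} {n : ℕ} :
    Subsingleton (Ext X (Y ⊞ Y') n) ↔ Subsingleton (Ext X Y n) ∧ Subsingleton (Ext X Y' n) :=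
  Ext.addEquivBiprod.subsingleton_congr.trans subsingleton_prod_iff

theorem surjective_precomp_mk₀_iff {X X' : C} (f : X ⟶ X') (Y : C) :
    Function.Surjective ((Ext.mk₀ f).precomp Y (zero_add 0)) ↔
      Function.Surjective fun u : X' ⟶ Y => f ≫ u :=
  (surjective_iff_of_comm Ext.homEquiv₀.symm Ext.homEquiv₀.symm fun u =>
    (Ext.mk₀_comp_mk₀ f u).symm).symm

theorem surjective_postcomp_mk₀_iff (X : C) {Y Y' : C} (g : Y ⟶ Y') :
    Function.Surjective ((Ext.mk₀ g).postcomp X (add_zero 0)) ↔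
      Function.Surjective fun u : X ⟶ Y => u ≫ g :=
  (surjective_iff_of_comm Ext.homEquiv₀.symm Ext.homEquiv₀.symm fun u =>
    (Ext.mk₀_comp_mk₀ u g).symm).symm

section ShortExact

variable {S : ShortComplex C} (hS : S.ShortExact) (Y : C)
include hS

theorem subsingleton_ext_succ_iff_surjective_precomp (n : ℕ)
    [Subsingleton (Ext S.X₂ Y (n + 1))] :
    Subsingleton (Ext S.X₃ Y (n + 1)) ↔
      Function.Surjective ((Ext.mk₀ S.f).precomp Y (zero_add n)) := by
  constructor
  · exact fun _ x => Ext.contravariant_sequence_exact₁ hS Y x (add_comm 1 n) (Subsingleton.elim _ _)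
  · refine fun h => subsingleton_of_forall_eq 0 fun x => ?_
    obtain ⟨y, rfl⟩ :=
      Ext.contravariant_sequence_exact₃ hS Y x (Subsingleton.elim _ _) (add_comm 1 n)
    obtain ⟨z, rfl⟩ := h y
    exact hS.extClass_comp_assoc z

theorem subsingleton_ext_succ_iff_surjective_postcomp (n : ℕ)
    [Subsingleton (Ext Y S.X₂ (n + 1))] :
    Subsingleton (Ext Y S.X₁ (n + 1)) ↔
      Function.Surjective ((Ext.mk₀ S.g).postcomp Y (add_zero n)) := by
  constructor
  · exact fun _ x => Ext.covariant_sequence_exact₃ Y hS x rfl (Subsingleton.elim _ _)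
  · refine fun h => subsingleton_of_forall_eq 0 fun x => ?_
    obtain ⟨y, rfl⟩ := Ext.covariant_sequence_exact₁ Y hS x (Subsingleton.elim _ _) rfl
    obtain ⟨z, rfl⟩ := h y
    have : (z.comp (Ext.mk₀ S.g) (add_zero n)).comp hS.extClass rfl = 0 := by
      rw [Ext.comp_assoc_of_second_deg_zero, hS.comp_extClass, Ext.comp_zero]
    exact this

theorem forall_subsingleton_ext_X₃_iff [∀ n, Subsingleton (Ext S.X₂ Y (n + 1))] :
    (∀ n, Subsingleton (Ext S.X₃ Y (n + 1))) ↔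
      (Function.Surjective fun u : S.X₂ ⟶ Y => S.f ≫ u) ∧
        ∀ n, Subsingleton (Ext S.X₁ Y (n + 1)) := by
  simp only [subsingleton_ext_succ_iff_surjective_precomp hS]
  rw [← Nat.and_forall_add_one, surjective_precomp_mk₀_iff]
  simp only [surjective_iff_subsingleton]

theorem forall_subsingleton_ext_X₁_iff [∀ n, Subsingleton (Ext Y S.X₂ (n + 1))] :
    (∀ n, Subsingleton (Ext Y S.X₁ (n + 1))) ↔
      (Function.Surjective fun u : Y ⟶ S.X₂ => u ≫ S.g) ∧
        ∀ n, Subsingleton (Ext Y S.X₃ (n + 1)) := by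
  simp only [subsingleton_ext_succ_iff_surjective_postcomp hS]
  rw [← Nat.and_forall_add_one, surjective_postcomp_mk₀_iff]
  simp only [surjective_iff_subsingleton]

end ShortExact

section Adjunction

variable {D : Type u'} [Category.{v'} D] [Abelian D] [HasExt.{w'} D] {L : C ⥤ D} {R : D ⥤ C}
  (adj : L ⊣ R) [L.Additive] [PreservesFiniteLimits L] [PreservesFiniteColimits L]

/-- The comparison map `Ext(X, R Y) → Ext(L X, Y)` of an adjunction `L ⊣ R` with `L` exact. -/
def extAdjunctionHom (X : C) (Y : D) (n : ℕ) : Ext X (R.obj Y) n →+ Ext (L.obj X) Y n :=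
  ((Ext.mk₀ (adj.counit.app Y)).postcomp (L.obj X) (add_zero n)).comp
    (L.mapExtAddHom X (R.obj Y) n)

theorem extAdjunctionHom_mk₀_comp {X X' : C} {Y : D} {n : ℕ} (f : X ⟶ X')
    (y : Ext X' (R.obj Y) n) :
    extAdjunctionHom adj X Y n ((Ext.mk₀ f).comp y (zero_add n)) =
      (Ext.mk₀ (L.map f)).comp (extAdjunctionHom adj X' Y n y) (zero_add n) := by
  simp [extAdjunctionHom, Ext.mapExactFunctor_comp, Ext.mapExactFunctor_mk₀]

theorem extAdjunctionHom_extClass_comp {S : ShortComplex C} (hS : S.ShortExact) {Y : D} {n : ℕ}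
    (y : Ext S.X₁ (R.obj Y) n) :
    extAdjunctionHom adj S.X₃ Y (n + 1) (hS.extClass.comp y (add_comm 1 n)) =
      (hS.map_of_exact L).extClass.comp (extAdjunctionHom adj S.X₁ Y n y) (add_comm 1 n) := by
  simp only [extAdjunctionHom, AddMonoidHom.comp_apply, Functor.mapExtAddHom_apply,
    Ext.mapExactFunctor_comp, Ext.mapExactFunctor_extClass]
  exact Ext.comp_assoc_of_third_deg_zero _ _ _ _

theorem extAdjunctionHom_bijective [EnoughProjectives C] [R.PreservesEpimorphisms] (X : C) (Y : D)
    (n : ℕ) : Function.Bijective (extAdjunctionHom adj X Y n) := by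
  induction n generalizing X with
  | zero =>
    have comm : extAdjunctionHom adj X Y 0 ∘ Ext.homEquiv₀.symm =
        Ext.homEquiv₀.symm ∘ (adj.homEquiv X Y).symm := by
      ext u
      simp [extAdjunctionHom, Ext.homEquiv₀, Ext.mapExactFunctor_mk₀, Adjunction.homEquiv_counit]
    rw [← Function.Bijective.of_comp_iff _ Ext.homEquiv₀.symm.bijective, comm]
    exact Ext.homEquiv₀.symm.bijective.comp (adj.homEquiv X Y).symm.bijective
  | succ n ih =>
    let P : ProjectivePresentation X := Classical.arbitrary _
    let S := ShortComplex.mk _ _ (kernel.condition P.f)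
    have hS : S.ShortExact := { exact := ShortComplex.exact_kernel P.f }
    have : Projective S.X₂ := P.projective
    have : L.PreservesProjectiveObjects :=
      L.preservesProjectiveObjects_of_adjunction_of_preservesEpimorphisms adj
    have : Projective (S.map L).X₂ := L.projective_obj_of_projective P.projective
    have surj (x : Ext S.X₃ (R.obj Y) (n + 1)) :=
      Ext.contravariant_sequence_exact₃ hS _ x (Ext.eq_zero_of_projective _) (add_comm 1 n)
    have surj' (y : Ext (L.obj S.X₃) Y (n + 1)) := Ext.contravariant_sequence_exact₃
      (hS.map_of_exact L) _ y (Ext.eq_zero_of_projective _) (add_comm 1 n)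
    refine AddMonoidHom.bijective_of_surjective_of_bijective_of_right_exact
      ((Ext.mk₀ S.f).precomp (R.obj Y) (zero_add n)) (hS.extClass.precomp (R.obj Y) (add_comm 1 n))
      ((Ext.mk₀ (L.map S.f)).precomp Y (zero_add n))
      ((hS.map_of_exact L).extClass.precomp Y (add_comm 1 n)) (extAdjunctionHom adj S.X₂ Y n)
      (extAdjunctionHom adj S.X₁ Y n) (extAdjunctionHom adj S.X₃ Y (n + 1)) ?_ ?_
      ((ShortComplex.ab_exact_iff_function_exact _).1
        (Ext.contravariant_sequence_exact₁' hS _ n _ (add_comm 1 n)))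
      ((ShortComplex.ab_exact_iff_function_exact _).1
        (Ext.contravariant_sequence_exact₁' (hS.map_of_exact L) _ n _ (add_comm 1 n)))
      (ih _).2 (ih _) surj surj'
    · exact AddMonoidHom.ext fun x => (extAdjunctionHom_mk₀_comp adj S.f x).symm
    · exact AddMonoidHom.ext fun x => (extAdjunctionHom_extClass_comp adj hS x).symm

end Adjunction

end AbelianExt

section ModuleExt

open Abelian Limits

variable {S : Type u} [Ring S] {K P M N N' : Type u} [AddCommGroup K] [Module S K]
  [AddCommGroup P] [Module S P] [AddCommGroup M] [Module S M] [AddCommGroup N] [Module S N]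
  [AddCommGroup N'] [Module S N']

theorem extVanishes_congr {S' : Type u} [Ring S'] {σ : S →+* S'} {σ' : S' →+* S}
    [RingHomInvPair σ σ'] [RingHomInvPair σ' σ] {M' N' : Type u} [AddCommGroup M'] [Module S' M']
    [AddCommGroup N'] [Module S' N'] (e : M ≃ₛₗ[σ] M') (e' : N ≃ₛₗ[σ] N') :
    ExtVanishes S M N ↔ ExtVanishes S' M' N' := by
  let F := (ModuleCat.restrictScalarsEquivalenceOfRingEquiv.{u}
    (RingHomInvPair.toRingEquiv σ σ')).functor
  let i : M ≃ₗ[S] F.obj (ModuleCat.of S' M') := { e with map_smul' := e.map_smulₛₗ }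
  let i' : N ≃ₗ[S] F.obj (ModuleCat.of S' N') := { e' with map_smul' := e'.map_smulₛₗ }
  have mapExt (n : ℕ) := Equiv.ofBijective _ (F.mapExt_bijective_of_preservesProjectiveObjects
    (ModuleCat.of S' M') (ModuleCat.of S' N') n)
  exact forall₂_congr fun n _ => (subsingleton_ext_congr i.toModuleIso i'.toModuleIso n).trans
    (mapExt n).symm.subsingleton_congr

theorem extVanishes_prod_left_iff :
    ExtVanishes S (K × M) N ↔ ExtVanishes S K N ∧ ExtVanishes S M N := by
  simp only [ExtVanishes, ← forall_and]
  exact forall₂_congr fun n _ => (subsingleton_ext_congr (ModuleCat.biprodIsoProd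
    (.of S K) (.of S M)).symm (Iso.refl _) n).trans subsingleton_ext_biprod_left_iff

theorem extVanishes_prod_right_iff :
    ExtVanishes S M (N × N') ↔ ExtVanishes S M N ∧ ExtVanishes S M N' := by
  simp only [ExtVanishes, ← forall_and]
  exact forall₂_congr fun n _ => (subsingleton_ext_congr (Iso.refl _) (ModuleCat.biprodIsoProd
    (.of S N) (.of S N')).symm n).trans subsingleton_ext_biprod_right_iff

theorem extVanishes_iff_forall_succ :
    ExtVanishes S M N ↔ ∀ n, Subsingleton (Ext (ModuleCat.of S M) (ModuleCat.of S N) (n + 1)) :=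
  ⟨fun h n => h (n + 1) n.succ_pos, fun h n hn => Nat.sub_add_cancel hn ▸ h (n - 1)⟩

section ShortExact

variable {f : K →ₗ[S] P} {g : P →ₗ[S] M} (hf : Function.Injective f)
  (hg : Function.Surjective g) (hfg : Function.Exact f g)
include hf hg hfg

theorem extVanishes_quotient_iff (hP : ExtVanishes S P N) :
    ExtVanishes S M N ↔
      (Function.Surjective fun u : P →ₗ[S] N => u ∘ₗ f) ∧ ExtVanishes S K N := by
  have hT := ModuleCat.shortComplex_shortExact
    (ModuleCat.shortComplexOfCompEqZero f g hfg.linearMap_comp_eq_zero) hfg hf hg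
  have surj_hom :
      (Function.Surjective fun u : ModuleCat.of S P ⟶ .of S N => ModuleCat.ofHom f ≫ u) ↔
        Function.Surjective fun u : P →ₗ[S] N => u ∘ₗ f :=
    surjective_iff_of_comm ModuleCat.homEquiv ModuleCat.homEquiv fun _ => rfl
  rw [extVanishes_iff_forall_succ] at hP ⊢
  rw [extVanishes_iff_forall_succ, ← surj_hom]
  exact forall_subsingleton_ext_X₃_iff hT (.of S N)

theorem extVanishes_sub_iff (hP : ExtVanishes S N P) :
    ExtVanishes S N K ↔
      (Function.Surjective fun u : N →ₗ[S] P => g ∘ₗ u) ∧ ExtVanishes S N M := by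
  have hT := ModuleCat.shortComplex_shortExact
    (ModuleCat.shortComplexOfCompEqZero f g hfg.linearMap_comp_eq_zero) hfg hf hg
  have surj_hom :
      (Function.Surjective fun u : ModuleCat.of S N ⟶ .of S P => u ≫ ModuleCat.ofHom g) ↔
        Function.Surjective fun u : N →ₗ[S] P => g ∘ₗ u :=
    surjective_iff_of_comm ModuleCat.homEquiv ModuleCat.homEquiv fun _ => rfl
  rw [extVanishes_iff_forall_succ] at hP ⊢
  rw [extVanishes_iff_forall_succ, ← surj_hom]
  exact forall_subsingleton_ext_X₁_iff hT (.of S N)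

end ShortExact

section Coinduction

variable {B : Type u} [Ring B] (f : B →+* S)

instance [Module.Projective B ((ModuleCat.restrictScalars.{u} f).obj (.of S S))] :
    (ModuleCat.coextendScalars.{u} f).PreservesEpimorphisms where
  preserves g hg := by
    rw [ModuleCat.epi_iff_surjective] at hg ⊢
    exact fun u => Module.projective_lifting_property g.hom u hg

instance : PreservesFiniteLimits (ModuleCat.restrictScalars.{u} f) where
  preservesFiniteLimits _ _ _ := ⟨inferInstance⟩

instance : PreservesFiniteColimits (ModuleCat.restrictScalars.{u} f) :=
  have := (ModuleCat.restrictCoextendScalarsAdj.{u} f).leftAdjoint_preservesColimits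
  inferInstance

theorem extVanishes_coextendScalars_iff
    [Module.Projective B ((ModuleCat.restrictScalars.{u} f).obj (.of S S))] (N : ModuleCat.{u} B) :
    ExtVanishes S M ((ModuleCat.coextendScalars f).obj N) ↔
      ExtVanishes B ((ModuleCat.restrictScalars f).obj (.of S M)) N :=
  forall₂_congr fun n _ => (Equiv.ofBijective _ <| extAdjunctionHom_bijective
    (ModuleCat.restrictCoextendScalarsAdj.{u} f) (.of S M) N n).subsingleton_congr

end Coinduction

end ModuleExt

section Triples

variable {B : Type u} [Ring B] {X Y X' Y' N : Type u} [AddCommGroup X] [Module B X]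
  [AddCommGroup Y] [Module B Y] [AddCommGroup X'] [Module B X'] [AddCommGroup Y'] [Module B Y']
  [AddCommGroup N] [Module B N] {φ : Y →ₗ[B] X} {φ' : Y' →ₗ[B] X'}

namespace T2

/-- The upper triangular matrix `(a b; 0 d)`. -/
def mk (a b d : B) : T2 B := ⟨!![a, b; 0, d], show !![a, b; 0, d] 1 0 = 0 by simp⟩

@[simp] theorem mk_zero_zero (a b d : B) : (mk a b d).1 0 0 = a := rfl
@[simp] theorem mk_zero_one (a b d : B) : (mk a b d).1 0 1 = b := rfl
@[simp] theorem mk_one_one (a b d : B) : (mk a b d).1 1 1 = d := rfl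

theorem ext_entries {m n : T2 B} (h₀ : m.1 0 0 = n.1 0 0) (h₁ : m.1 0 1 = n.1 0 1)
    (h₂ : m.1 1 1 = n.1 1 1) : m = n := by
  have h : m.1 1 0 = n.1 1 0 := (show m.1 1 0 = 0 from m.2).trans n.2.symm
  ext i j
  fin_cases i <;> fin_cases j <;> assumption

@[simp] theorem mul_zero_zero (m n : T2 B) : (m * n).1 0 0 = m.1 0 0 * n.1 0 0 := by
  have hn : n.1 1 0 = 0 := n.2
  simp [Matrix.mul_apply, hn]

@[simp] theorem mul_zero_one (m n : T2 B) :
    (m * n).1 0 1 = m.1 0 0 * n.1 0 1 + m.1 0 1 * n.1 1 1 := by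
  simp [Matrix.mul_apply]

@[simp] theorem mul_one_one (m n : T2 B) : (m * n).1 1 1 = m.1 1 1 * n.1 1 1 := by
  have hm : m.1 1 0 = 0 := m.2
  simp [Matrix.mul_apply, hm]

variable (B) in
/-- The diagonal embedding of `B` into `T₂(B)`. -/
def diag : B →+* T2 B where
  toFun b := mk b 0 b
  map_one' := ext_entries rfl rfl rfl
  map_zero' := ext_entries rfl rfl rfl
  map_add' _ _ := ext_entries rfl (add_zero 0).symm rfl
  map_mul' _ _ := ext_entries (by simp) (by simp) (by simp)

variable (B) in
/-- The entries of a triangular matrix, `T₂(B)` being a `B`-module through `T2.diag`. -/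
def entriesEquiv :
    (ModuleCat.restrictScalars (diag B)).obj (.of (T2 B) (T2 B)) ≃ₗ[B] B × B × B where
  toFun (m : T2 B) := (m.1 0 0, m.1 0 1, m.1 1 1)
  invFun t := mk t.1 t.2.1 t.2.2
  left_inv _ := ext_entries rfl rfl rfl
  right_inv _ := rfl
  map_add' _ _ := rfl
  map_smul' b (m : T2 B) := by
    change ((diag B b * m).1 0 0, (diag B b * m).1 0 1, (diag B b * m).1 1 1) = _
    simp [diag]

instance : Module.Projective B ((ModuleCat.restrictScalars.{u} (diag B)).obj (.of (T2 B) (T2 B))) :=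
  .of_equiv (entriesEquiv B).symm

end T2

namespace Triple

@[simp] theorem fst_mk (x : X) (y : Y) : (mk φ x y).1 = x := rfl
@[simp] theorem snd_mk (x : X) (y : Y) : (mk φ x y).2 = y := rfl
@[simp] theorem fst_add (z w : Triple φ) : (z + w).1 = z.1 + w.1 := rfl
@[simp] theorem snd_add (z w : Triple φ) : (z + w).2 = z.2 + w.2 := rfl

@[simp] theorem fst_smul (m : T2 B) (z : Triple φ) :
    (m • z).1 = m.1 0 0 • z.1 + m.1 0 1 • φ z.2 := rfl
@[simp] theorem snd_smul (m : T2 B) (z : Triple φ) : (m • z).2 = m.1 1 1 • z.2 := rfl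

/-- The map of triples given by a commutative square. -/
def map (a : X →ₗ[B] X') (b : Y →ₗ[B] Y') (h : a ∘ₗ φ = φ' ∘ₗ b) :
    Triple φ →ₗ[T2 B] Triple φ' where
  toFun z := mk φ' (a z.1) (b z.2)
  map_add' _ _ := Prod.ext (map_add a _ _) (map_add b _ _)
  map_smul' m z := by
    have h : a (φ z.2) = φ' (b z.2) := LinearMap.congr_fun h z.2
    exact Prod.ext (by simp [h]) (by simp)

/-- The map `X → X'` underlying a map of triples. -/
def topHom (u : Triple φ →ₗ[T2 B] Triple φ') : X →ₗ[B] X' where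
  toFun x := (u (mk φ x 0)).1
  map_add' x x' := by
    rw [← fst_add, ← map_add]
    exact congrArg (fun y => (u (mk φ (x + x') y)).1) (add_zero 0).symm
  map_smul' c x := by
    have h : mk φ (c • x) 0 = T2.diag B c • mk φ x 0 := Prod.ext (by simp [T2.diag]) (by simp)
    simp [h, T2.diag]

/-- The map `Y → Y'` underlying a map of triples. -/
def bottomHom (u : Triple φ →ₗ[T2 B] Triple φ') : Y →ₗ[B] Y' where
  toFun y := (u (mk φ 0 y)).2
  map_add' y y' := by
    rw [← snd_add, ← map_add]
    exact congrArg (fun x => (u (mk φ x (y + y'))).2) (add_zero 0).symm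
  map_smul' c y := by
    have h : mk φ 0 (c • y) = T2.mk 0 0 c • mk φ 0 y := Prod.ext (by simp) (by simp)
    simp [h]

theorem topHom_comp (u : Triple φ →ₗ[T2 B] Triple φ') : topHom u ∘ₗ φ = φ' ∘ₗ bottomHom u := by
  ext y
  have h : mk φ (φ y) 0 = T2.mk (0 : B) 1 0 • mk φ 0 y := Prod.ext (by simp) (by simp)
  simp [topHom, bottomHom, h]

theorem map_topHom_bottomHom (u : Triple φ →ₗ[T2 B] Triple φ') :
    map (topHom u) (bottomHom u) (topHom_comp u) = u := by
  ext z
  have h₀ : mk φ z.1 0 = T2.mk (1 : B) 0 0 • z := Prod.ext (by simp) (by simp)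
  have h₁ : mk φ 0 z.2 = T2.mk (0 : B) 0 1 • z := Prod.ext (by simp) (by simp)
  exact Prod.ext (by simp [map, topHom, h₀]) (by simp [map, bottomHom, h₁])

end Triple

open Triple

section Special

variable (B N)

/-- The triple `(N, N)` of the identity of `N`. -/
abbrev idTriple : Type u := Triple (LinearMap.id : N →ₗ[B] N)

/-- The triple `(0, N)`. -/
abbrev bottomTriple : Type u := Triple (0 : N →ₗ[B] PUnit.{u + 1})

/-- The triple `(N, 0)`. -/
abbrev topTriple : Type u := Triple (0 : PUnit.{u + 1} →ₗ[B] N)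

/-- The inclusion `(N, 0) → (N, N)`. -/
def topToId : topTriple B N →ₗ[T2 B] idTriple B N := map LinearMap.id 0 rfl

/-- The projection `(N, N) → (0, N)`. -/
def idToBottom : idTriple B N →ₗ[T2 B] bottomTriple B N := map 0 LinearMap.id rfl

theorem topToId_injective : Function.Injective (topToId B N) := fun _ _ h =>
  Prod.ext (congrArg (fun z : idTriple B N => z.1) h) rfl

theorem idToBottom_surjective : Function.Surjective (idToBottom B N) := fun z =>
  ⟨mk _ 0 z.2, rfl⟩

theorem topToId_exact_idToBottom : Function.Exact (topToId B N) (idToBottom B N) := fun z =>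
  ⟨fun h => ⟨mk _ z.1 0, Prod.ext rfl (congrArg Prod.snd h).symm⟩,
    fun ⟨_, h⟩ => Prod.ext rfl (congrArg Prod.snd h).symm⟩

end Special

section HomEquivs

variable (N φ)

/-- Maps of a triple `(X, Y)` into `(N, N)` are maps `X → N`. -/
def homIdTripleEquiv : (Triple φ →ₗ[T2 B] idTriple B N) ≃+ (X →ₗ[B] N) where
  toFun := topHom
  invFun a := map a (a ∘ₗ φ) rfl
  left_inv u :=
    have h : map (topHom u) (topHom u ∘ₗ φ) rfl = map (topHom u) (bottomHom u) (topHom_comp u) :=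
      LinearMap.ext fun z => Prod.ext rfl (LinearMap.congr_fun (topHom_comp u) z.2)
    h.trans (map_topHom_bottomHom u)
  right_inv _ := rfl
  map_add' _ _ := rfl

/-- Maps of a triple `(X, Y)` into `(0, N)` are maps `Y → N`. -/
def homBottomTripleEquiv : (Triple φ →ₗ[T2 B] bottomTriple B N) ≃+ (Y →ₗ[B] N) where
  toFun := bottomHom
  invFun b := map 0 b rfl
  left_inv u := map_topHom_bottomHom u
  right_inv _ := rfl
  map_add' _ _ := rfl

/-- Maps of a triple `(X, Y)` of `φ` into `(N, 0)` are maps `Coker φ → N`. -/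
def homTopTripleEquiv : (Triple φ →ₗ[T2 B] topTriple B N) ≃+ (Coker φ →ₗ[B] N) where
  toFun u := (LinearMap.range φ).liftQ (topHom u) <|
    LinearMap.range_le_ker_iff.2 (topHom_comp u)
  invFun g := map (g ∘ₗ proj φ) 0 (by simp [LinearMap.comp_assoc, LinearMap.range_mkQ_comp])
  left_inv u := map_topHom_bottomHom u
  right_inv _ := Submodule.linearMap_qext _ rfl
  map_add' _ _ := Submodule.linearMap_qext _ rfl

/-- Maps of a triple `(X, Y)` of `φ` into `(N, N) ⊕ (N, 0)` are pairs of maps `X → N` and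
`Coker φ → N`. -/
def homIdProdTopEquiv : (Triple φ →ₗ[T2 B] idTriple B N × topTriple B N) ≃+
    (X →ₗ[B] N) × (Coker φ →ₗ[B] N) :=
  (LinearMap.prodEquiv ℤ).symm.toAddEquiv.trans <|
    (homIdTripleEquiv N φ).prodCongr (homTopTripleEquiv N φ)

theorem surjective_idToBottom_comp_iff :
    (Function.Surjective fun u : Triple φ →ₗ[T2 B] idTriple B N => idToBottom B N ∘ₗ u) ↔
      Function.Surjective fun u : X →ₗ[B] N => u ∘ₗ φ :=
  surjective_iff_of_comm (homIdTripleEquiv N φ).toEquiv (homBottomTripleEquiv N φ).toEquiv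
    fun u => (topHom_comp u).symm

end HomEquivs

section TripleExt

theorem T2.linearMap_apply_eq_entries
    (f : (ModuleCat.restrictScalars (T2.diag B)).obj (.of (T2 B) (T2 B)) →ₗ[B] N) (m : T2 B) :
    f m = m.1 0 0 • f (T2.mk 1 0 0) + (m.1 0 1 • f (T2.mk 0 1 0) + m.1 1 1 • f (T2.mk 0 0 1)) := by
  let F : B × B × B →ₗ[B] N := f ∘ₗ (T2.entriesEquiv B).symm.toLinearMap
  have decompose (t : B × B × B) :
      t = t.1 • (1, 0, 0) + (t.2.1 • (0, 1, 0) + t.2.2 • (0, 0, 1)) :=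
    Prod.ext (by simp) (Prod.ext (by simp) (by simp))
  have h := congrArg F (decompose (T2.entriesEquiv B m))
  rw [map_add, map_add, map_smul, map_smul, map_smul] at h
  exact (congrArg f ((T2.entriesEquiv B).symm_apply_apply m)).symm.trans h

variable (B N) in
/-- The coinduced module `Hom_B(T₂(B), N)` is `(N, N) ⊕ (0, N)`. -/
def coextendDiagEquiv : (ModuleCat.coextendScalars.{u} (T2.diag B)).obj (.of B N) ≃ₗ[T2 B]
    idTriple B N × bottomTriple B N where
  toFun (f : (ModuleCat.restrictScalars (T2.diag B)).obj (.of (T2 B) (T2 B)) →ₗ[B] N) :=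
    (mk _ (f (T2.mk 1 0 0)) (f (T2.mk 0 1 0)), mk _ PUnit.unit (f (T2.mk 0 0 1)))
  invFun z := ((LinearMap.toSpanSingleton B N z.1.1).coprod
    ((LinearMap.toSpanSingleton B N z.1.2).coprod (LinearMap.toSpanSingleton B N z.2.2))) ∘ₗ
      (T2.entriesEquiv B).toLinearMap
  left_inv f := LinearMap.ext fun m => (T2.linearMap_apply_eq_entries f m).symm
  right_inv z := by
    refine Prod.ext (Prod.ext ?_ ?_) (Prod.ext rfl ?_)
    · exact (by simp : (1 : B) • z.1.1 + ((0 : B) • z.1.2 + (0 : B) • z.2.2) = z.1.1)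
    · exact (by simp : (0 : B) • z.1.1 + ((1 : B) • z.1.2 + (0 : B) • z.2.2) = z.1.2)
    · exact (by simp : (0 : B) • z.1.1 + ((0 : B) • z.1.2 + (1 : B) • z.2.2) = z.2.2)
  map_add' _ _ := rfl
  map_smul' m f := by
    refine Prod.ext (Prod.ext ?_ ?_) (Prod.ext rfl ?_)
    · exact (T2.linearMap_apply_eq_entries f (T2.mk 1 0 0 * m)).trans (by simp)
    · exact (T2.linearMap_apply_eq_entries f (T2.mk 0 1 0 * m)).trans (by simp)
    · exact (T2.linearMap_apply_eq_entries f (T2.mk 0 0 1 * m)).trans (by simp)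

variable (φ) in
/-- The triple `(X, Y)` is the `B`-module `X ⊕ Y` when restricted along the diagonal. -/
def restrictDiagEquiv : (ModuleCat.restrictScalars.{u} (T2.diag B)).obj (.of (T2 B) (Triple φ))
    ≃ₗ[B] X × Y where
  toFun z := z
  invFun z := z
  map_add' _ _ := rfl
  map_smul' b z := Prod.ext
    ((congrArg _ (zero_smul B (φ z.2))).trans (add_zero _)) rfl

theorem extVanishes_idTriple_and_bottomTriple_iff :
    ExtVanishes (T2 B) (Triple φ) (idTriple B N) ∧ ExtVanishes (T2 B) (Triple φ) (bottomTriple B N)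
      ↔ ExtVanishes B X N ∧ ExtVanishes B Y N := by
  rw [← extVanishes_prod_right_iff, ← extVanishes_prod_left_iff,
    ← extVanishes_congr (.refl _ _) (coextendDiagEquiv B N), extVanishes_coextendScalars_iff]
  exact extVanishes_congr (restrictDiagEquiv φ) (.refl _ _)

theorem extVanishes_idTriple_prod_topTriple_iff :
    ExtVanishes (T2 B) (Triple φ) (idTriple B N × topTriple B N) ↔
      ExtVanishes B X N ∧ ExtVanishes B Y N ∧ Function.Surjective fun u : X →ₗ[B] N => u ∘ₗ φ := by
  rw [← and_assoc, ← extVanishes_idTriple_and_bottomTriple_iff, extVanishes_prod_right_iff,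
    and_assoc]
  refine and_congr_right fun h => ?_
  rw [extVanishes_sub_iff (topToId_injective B N) (idToBottom_surjective B N)
    (topToId_exact_idToBottom B N) h, surjective_idToBottom_comp_iff, and_comm]

end TripleExt

end Triples

section Dual

variable {A : Type u} [Ring A] {X Y : Type u} [AddCommGroup X] [Module A X] [AddCommGroup Y]
  [Module A Y]

namespace T2

variable (A)

/-- The isomorphism `T₂(A)ᵐᵒᵖ ≃ T₂(Aᵐᵒᵖ)` given by reflection in the antidiagonal. -/
def opEquiv : (T2 A)ᵐᵒᵖ ≃+* T2 Aᵐᵒᵖ where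
  toFun m := mk (op (m.unop.1 1 1)) (op (m.unop.1 0 1)) (op (m.unop.1 0 0))
  invFun m := op (mk (m.1 1 1).unop (m.1 0 1).unop (m.1 0 0).unop)
  left_inv _ := unop_injective (ext_entries rfl rfl rfl)
  right_inv _ := ext_entries rfl rfl rfl
  map_add' _ _ := ext_entries rfl rfl rfl
  map_mul' _ _ := ext_entries (by simp) (by simp [add_comm]) (by simp)

instance : RingHomInvPair (opEquiv A : (T2 A)ᵐᵒᵖ →+* T2 Aᵐᵒᵖ) (opEquiv A).symm :=
  .of_ringEquiv _

instance : RingHomInvPair ((opEquiv A).symm : T2 Aᵐᵒᵖ →+* (T2 A)ᵐᵒᵖ) (opEquiv A) :=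
  .of_ringEquiv_symm _

/-- The decomposition `T₂(A) = (A, A) ⊕ (A, 0)` into columns. -/
def columnsEquiv : T2 A ≃ₗ[T2 A] idTriple A A × topTriple A A where
  toFun m := (Triple.mk _ (m.1 0 1) (m.1 1 1), Triple.mk _ (m.1 0 0) PUnit.unit)
  invFun z := mk z.2.1 z.1.1 z.1.2
  left_inv _ := ext_entries rfl rfl rfl
  right_inv _ := rfl
  map_add' _ _ := rfl
  map_smul' _ _ := Prod.ext (Prod.ext (by simp) (by simp)) (Prod.ext (by simp) rfl)

/-- The decomposition of `T₂(A)` into rows, as right modules. -/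
def rowsEquiv :
    T2 A ≃ₛₗ[(opEquiv A : (T2 A)ᵐᵒᵖ →+* T2 Aᵐᵒᵖ)] idTriple Aᵐᵒᵖ A × topTriple Aᵐᵒᵖ A where
  toFun m := (Triple.mk _ (m.1 0 1) (m.1 0 0), Triple.mk _ (m.1 1 1) PUnit.unit)
  invFun z := mk z.1.2 z.1.1 z.2.1
  left_inv _ := ext_entries rfl rfl rfl
  right_inv _ := rfl
  map_add' _ _ := rfl
  map_smul' _ _ := Prod.ext (Prod.ext (by simp [opEquiv, add_comm]) (by simp [opEquiv]))
    (Prod.ext (by simp [opEquiv]) rfl)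

end T2

variable (φ : Y →ₗ[A] X)

/-- The dual of the triple of `φ` is the triple of `π^*`: a functional
`(x, y) ↦ (g(π(x)) α(x); 0 α(φ(y)))` corresponds to `(α, g)`. -/
def dualEquiv : LDual (T2 A) (Triple φ) ≃ₛₗ[(T2.opEquiv A : (T2 A)ᵐᵒᵖ →+* T2 Aᵐᵒᵖ)]
    Triple (lDualMap (proj φ)) :=
  let e := (LinearEquiv.arrowCongrAddEquiv (.refl _ (Triple φ)) (T2.columnsEquiv A)).trans
    (homIdProdTopEquiv A φ)
  { e with
    map_smul' m f := Prod.ext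
      (LinearMap.ext fun x => (T2.mul_zero_one (f (Triple.mk φ x 0)) m.unop).trans (add_comm _ _))
      (Submodule.linearMap_qext _ <| LinearMap.ext fun x =>
        T2.mul_zero_zero (f (Triple.mk φ x 0)) m.unop) }

/-- The double dual of the triple of `φ` is the triple of `p^*`. -/
def doubleDualEquiv : RDual (T2 A) (LDual (T2 A) (Triple φ)) ≃ₗ[T2 A]
    Triple (rDualMap (pMap φ)) :=
  let e := (LinearEquiv.arrowCongrAddEquiv (dualEquiv φ) (T2.rowsEquiv A)).trans
    (homIdProdTopEquiv A (lDualMap (proj φ)))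
  { e with
    map_smul' m H := Prod.ext
      (LinearMap.ext fun α => T2.mul_zero_one m (H ((dualEquiv φ).symm (Triple.mk _ α 0))))
      (Submodule.linearMap_qext _ <| LinearMap.ext fun α =>
        T2.mul_one_one m (H ((dualEquiv φ).symm (Triple.mk _ α 0)))) }

end Dual

section Conclusion

variable {A : Type u} [Ring A] {X Y : Type u} [AddCommGroup X] [Module A X] [AddCommGroup Y]
  [Module A Y]

section DualMaps

theorem lDualMap_injective {f : Y →ₗ[A] X} (hf : Function.Surjective f) :
    Function.Injective (lDualMap f) :=
  fun _ _ => (LinearMap.cancel_right hf).1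

theorem lDualMap_exact (φ : Y →ₗ[A] X) : Function.Exact (lDualMap (proj φ)) (lDualMap φ) := by
  refine LinearMap.exact_iff.2 (le_antisymm (fun α hα => ?_) ?_)
  · exact ⟨(LinearMap.range φ).liftQ α (LinearMap.range_le_ker_iff.2 hα), rfl⟩
  · rintro _ ⟨g, rfl⟩
    exact (LinearMap.comp_assoc _ _ _).trans (by rw [LinearMap.range_mkQ_comp, LinearMap.comp_zero])

variable {U V : Type u} [AddCommGroup U] [Module Aᵐᵒᵖ U] [AddCommGroup V] [Module Aᵐᵒᵖ V]
  {f : U →ₗ[Aᵐᵒᵖ] V}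

theorem rDualMap_injective (hf : Function.Surjective f) : Function.Injective (rDualMap f) :=
  fun _ _ => (LinearMap.cancel_right hf).1

theorem rDualMap_bijective (hf : Function.Bijective f) : Function.Bijective (rDualMap f) :=
  (LinearEquiv.arrowCongrAddEquiv (LinearEquiv.ofBijective f hf).symm (.refl _ A)).bijective

end DualMaps

variable {φ : Y →ₗ[A] X}

theorem beta_bijective (h : Function.Surjective (lDualMap φ)) : Function.Bijective (beta φ) := by
  constructor
  · exact LinearMap.ker_eq_bot.1 <|
      Submodule.ker_liftQ_eq_bot _ _ _ (lDualMap_exact φ).linearMap_ker_eq.le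
  · exact Function.Surjective.of_comp (g := pMap φ) h

theorem semiGP_triple_iff :
    SemiGP (T2 A) (Triple φ) ↔ SemiGP A X ∧ SemiGP A Y ∧ Function.Surjective (lDualMap φ) :=
  (extVanishes_congr (.refl _ _) (T2.columnsEquiv A)).trans extVanishes_idTriple_prod_topTriple_iff

theorem rSemiGP_dual_triple_iff :
    RSemiGP (T2 A) (LDual (T2 A) (Triple φ)) ↔
      RSemiGP A (LDual A X) ∧ RSemiGP A (LDual A (Coker φ)) ∧
        Function.Surjective (rDualMap (lDualMap (proj φ))) :=
  (extVanishes_congr (dualEquiv φ) (T2.rowsEquiv A)).trans extVanishes_idTriple_prod_topTriple_iff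

theorem rSemiGP_dual_iff (h : Function.Surjective (lDualMap φ)) (hX : RSemiGP A (LDual A X)) :
    RSemiGP A (LDual A Y) ↔
      Function.Surjective (rDualMap (lDualMap (proj φ))) ∧ RSemiGP A (LDual A (Coker φ)) :=
  extVanishes_quotient_iff (lDualMap_injective (Submodule.mkQ_surjective _)) h (lDualMap_exact φ) hX

theorem doubleSemiGP_triple_iff :
    DoubleSemiGP (T2 A) (Triple φ) ↔ Function.Surjective (lDualMap φ) ∧ DoubleSemiGP A X ∧
      DoubleSemiGP A Y ∧ RSemiGP A (LDual A (Coker φ)) := by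
  rw [DoubleSemiGP, semiGP_triple_iff, rSemiGP_dual_triple_iff]
  constructor
  · rintro ⟨⟨hX, hY, hs⟩, hX', hC, he⟩
    exact ⟨hs, ⟨hX, hX'⟩, ⟨hY, (rSemiGP_dual_iff hs hX').2 ⟨he, hC⟩⟩, hC⟩
  · rintro ⟨hs, ⟨hX, hX'⟩, ⟨hY, hY'⟩, hC⟩
    exact ⟨⟨hX, hY, hs⟩, hX', hC, ((rSemiGP_dual_iff hs hX').1 hY').1⟩

theorem semiGP_coker_iff (h : Function.Injective φ) (hX : SemiGP A X) :
    SemiGP A (Coker φ) ↔ Function.Surjective (lDualMap φ) ∧ SemiGP A Y :=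
  extVanishes_quotient_iff h (Submodule.mkQ_surjective _) (LinearMap.exact_map_mkQ_range φ) hX

theorem doubleDualEquiv_symm_apply (b : RDual A (LDual A X))
    (c : RDual A (CokerPiStar φ)) (f : LDual (T2 A) (Triple φ)) (g : LDual A (Coker φ))
    (α : LDual A X) (hf : ∀ x y, (f (Triple.mk φ x y) : Matrix (Fin 2) (Fin 2) A) =
      !![g (proj φ x), α x; 0, α (φ y)]) :
    ((doubleDualEquiv φ).symm (Triple.mk _ b c) f : Matrix (Fin 2) (Fin 2) A) =
      !![b (lDualMap (proj φ) g), b α; 0, c (pMap φ α)] := by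
  obtain rfl : f = (dualEquiv φ).symm (Triple.mk _ α g) :=
    LinearMap.ext fun z => Subtype.ext (hf z.1 z.2)
  rfl

theorem doubleDualEquiv_canon (x : X) (y : Y) :
    doubleDualEquiv φ (canon (T2 A) (Triple φ) (Triple.mk φ x y)) =
      Triple.mk _ (canon A X x) (rDualMap (beta φ) (canon A Y y)) :=
  Prod.ext rfl (Submodule.linearMap_qext _ rfl)

theorem canon_triple (x : X) (y : Y) :
    canon (T2 A) (Triple φ) (Triple.mk φ x y) =
      (doubleDualEquiv φ).symm (Triple.mk _ (canon A X x) (rDualMap (beta φ) (canon A Y y))) :=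
  (LinearEquiv.eq_symm_apply _).2 (doubleDualEquiv_canon x y)

theorem doubleDualEquiv_comp_canon : doubleDualEquiv φ ∘ canon (T2 A) (Triple φ) =
    Prod.map (canon A X) (rDualMap (beta φ) ∘ canon A Y) :=
  funext fun z => doubleDualEquiv_canon z.1 z.2

theorem torsionless_triple_iff (h : Function.Surjective (lDualMap φ)) :
    Torsionless (T2 A) (Triple φ) ↔ Torsionless A X ∧ Torsionless A Y := by
  rw [Torsionless, ← (doubleDualEquiv φ).injective.of_comp_iff, doubleDualEquiv_comp_canon]
  exact Prod.map_injective.trans <| and_congr_right' <|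
    (rDualMap_bijective (beta_bijective h)).injective.of_comp_iff _

theorem canon_triple_surjective_iff (h : Function.Surjective (lDualMap φ)) :
    Function.Surjective (canon (T2 A) (Triple φ)) ↔
      Function.Surjective (canon A X) ∧ Function.Surjective (canon A Y) := by
  rw [← Function.Surjective.of_comp_iff' (doubleDualEquiv φ).bijective, doubleDualEquiv_comp_canon]
  exact Prod.map_surjective.trans <| and_congr_right' <|
    Function.Surjective.of_comp_iff' (rDualMap_bijective (beta_bijective h)) _

theorem injective_of_torsionless (h : Function.Surjective (lDualMap φ)) (hY : Torsionless A Y) :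
    Function.Injective φ := fun y y' hy => hY <| LinearMap.ext fun f => by
  obtain ⟨α, rfl⟩ := h f
  exact congrArg α hy

end Conclusion

end T2Modules

end

theorem theorem1p5_general {A : Type u} [Ring A] {X Y : Type u} [AddCommGroup X] [Module A X]
    [AddCommGroup Y] [Module A Y] (φ : Y →ₗ[A] X) :
    (Function.Injective (T2Modules.rDualMap (T2Modules.pMap φ)) ∧
      ∃ h : T2Modules.Triple (T2Modules.rDualMap (T2Modules.pMap φ)) ≃ₗ[T2Modules.T2 A]
          T2Modules.RDual (T2Modules.T2 A)
            (T2Modules.LDual (T2Modules.T2 A) (T2Modules.Triple φ)),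
        (∀ (b : T2Modules.RDual A (T2Modules.LDual A X))
          (c : T2Modules.RDual A (T2Modules.CokerPiStar φ))
          (f : T2Modules.LDual (T2Modules.T2 A) (T2Modules.Triple φ))
          (g : T2Modules.LDual A (T2Modules.Coker φ)) (α : T2Modules.LDual A X),
          (∀ (x : X) (y : Y), (f (T2Modules.Triple.mk φ x y) : Matrix (Fin 2) (Fin 2) A) =
            !![g (T2Modules.proj φ x), α x; 0, α (φ y)]) →
          (h (T2Modules.Triple.mk _ b c) f : Matrix (Fin 2) (Fin 2) A) =
            !![b (T2Modules.lDualMap (T2Modules.proj φ) g), b α; 0, c (T2Modules.pMap φ α)]) ∧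
        ∀ (x : X) (y : Y),
          T2Modules.canon (T2Modules.T2 A) (T2Modules.Triple φ) (T2Modules.Triple.mk φ x y) =
            h (T2Modules.Triple.mk _ (T2Modules.canon A X x)
              (T2Modules.rDualMap (T2Modules.beta φ) (T2Modules.canon A Y y)))) ∧
    ((T2Modules.Torsionless (T2Modules.T2 A) (T2Modules.Triple φ) ∧
        T2Modules.DoubleSemiGP (T2Modules.T2 A) (T2Modules.Triple φ)) ↔
      (Function.Injective φ ∧
        T2Modules.DoubleSemiGP A X ∧ T2Modules.DoubleSemiGP A Y ∧
        T2Modules.DoubleSemiGP A (T2Modules.Coker φ) ∧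
        T2Modules.Torsionless A X ∧ T2Modules.Torsionless A Y)) ∧
    ((T2Modules.DoubleSemiGP (T2Modules.T2 A) (T2Modules.Triple φ) ∧
        Function.Surjective (T2Modules.canon (T2Modules.T2 A) (T2Modules.Triple φ))) ↔
      (Function.Surjective (T2Modules.lDualMap φ) ∧
        T2Modules.DoubleSemiGP A X ∧ T2Modules.DoubleSemiGP A Y ∧
        T2Modules.RSemiGP A (T2Modules.LDual A (T2Modules.Coker φ)) ∧
        Function.Surjective (T2Modules.canon A X) ∧
        Function.Surjective (T2Modules.canon A Y))) := by
  refine ⟨⟨T2Modules.rDualMap_injective (Submodule.mkQ_surjective _),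
    (T2Modules.doubleDualEquiv φ).symm, T2Modules.doubleDualEquiv_symm_apply,
    T2Modules.canon_triple⟩, ?_, ?_⟩
  · rw [T2Modules.doubleSemiGP_triple_iff]
    constructor
    · rintro ⟨hT, hs, hX, hY, hC⟩
      obtain ⟨hTX, hTY⟩ := (T2Modules.torsionless_triple_iff hs).1 hT
      have hφ := T2Modules.injective_of_torsionless hs hTY
      exact ⟨hφ, hX, hY, ⟨(T2Modules.semiGP_coker_iff hφ hX.1).2 ⟨hs, hY.1⟩, hC⟩, hTX, hTY⟩
    · rintro ⟨hφ, hX, hY, hC, hTX, hTY⟩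
      have hs := ((T2Modules.semiGP_coker_iff hφ hX.1).1 hC.1).1
      exact ⟨(T2Modules.torsionless_triple_iff hs).2 ⟨hTX, hTY⟩, hs, hX, hY, hC.2⟩
  · rw [T2Modules.doubleSemiGP_triple_iff]
    constructor
    · rintro ⟨⟨hs, hX, hY, hC⟩, he⟩
      exact ⟨hs, hX, hY, hC, (T2Modules.canon_triple_surjective_iff hs).1 he⟩
    · rintro ⟨hs, hX, hY, hC, he⟩
      exact ⟨⟨hs, hX, hY, hC⟩, (T2Modules.canon_triple_surjective_iff hs).2 he⟩

theorem theorem1p5 {R : Type*} [CommRing R] [IsArtinianRing R]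
    {A : Type u} [Ring A] [Algebra R A] [Module.Finite R A]
    {X Y : Type u} [AddCommGroup X] [Module A X] [Module.Finite A X]
    [AddCommGroup Y] [Module A Y] [Module.Finite A Y] (φ : Y →ₗ[A] X) :
    -- the double dual and the canonical map
    (Function.Injective (T2Modules.rDualMap (T2Modules.pMap φ)) ∧
      ∃ h : T2Modules.Triple (T2Modules.rDualMap (T2Modules.pMap φ)) ≃ₗ[T2Modules.T2 A]
          T2Modules.RDual (T2Modules.T2 A)
            (T2Modules.LDual (T2Modules.T2 A) (T2Modules.Triple φ)),
        (∀ (b : T2Modules.RDual A (T2Modules.LDual A X))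
          (c : T2Modules.RDual A (T2Modules.CokerPiStar φ))
          (f : T2Modules.LDual (T2Modules.T2 A) (T2Modules.Triple φ))
          (g : T2Modules.LDual A (T2Modules.Coker φ)) (α : T2Modules.LDual A X),
          (∀ (x : X) (y : Y), (f (T2Modules.Triple.mk φ x y) : Matrix (Fin 2) (Fin 2) A) =
            !![g (T2Modules.proj φ x), α x; 0, α (φ y)]) →
          (h (T2Modules.Triple.mk _ b c) f : Matrix (Fin 2) (Fin 2) A) =
            !![b (T2Modules.lDualMap (T2Modules.proj φ) g), b α; 0, c (T2Modules.pMap φ α)]) ∧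
        ∀ (x : X) (y : Y),
          T2Modules.canon (T2Modules.T2 A) (T2Modules.Triple φ) (T2Modules.Triple.mk φ x y) =
            h (T2Modules.Triple.mk _ (T2Modules.canon A X x)
              (T2Modules.rDualMap (T2Modules.beta φ) (T2Modules.canon A Y y)))) ∧
    -- torsionless and double semi-Gorenstein-projective
    ((T2Modules.Torsionless (T2Modules.T2 A) (T2Modules.Triple φ) ∧
        T2Modules.DoubleSemiGP (T2Modules.T2 A) (T2Modules.Triple φ)) ↔
      (Function.Injective φ ∧
        T2Modules.DoubleSemiGP A X ∧ T2Modules.DoubleSemiGP A Y ∧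
        T2Modules.DoubleSemiGP A (T2Modules.Coker φ) ∧
        T2Modules.Torsionless A X ∧ T2Modules.Torsionless A Y)) ∧
    -- double semi-Gorenstein-projective with epimorphic canonical map
    ((T2Modules.DoubleSemiGP (T2Modules.T2 A) (T2Modules.Triple φ) ∧
        Function.Surjective (T2Modules.canon (T2Modules.T2 A) (T2Modules.Triple φ))) ↔
      (Function.Surjective (T2Modules.lDualMap φ) ∧
        T2Modules.DoubleSemiGP A X ∧ T2Modules.DoubleSemiGP A Y ∧
        T2Modules.RSemiGP A (T2Modules.LDual A (T2Modules.Coker φ)) ∧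
        Function.Surjective (T2Modules.canon A X) ∧
        Function.Surjective (T2Modules.canon A Y))) :=
  theorem1p5_general φ
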